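/- Let $d\in\mathbb N$, $T>0$, $1\le p<\infty$, and let $\mathrm{Conv}(\mathbb R^d)$ be the family of nonempty compact convex subsets of $\mathbb R^d$ with the Hausdorff metric $H$. For a function $f$ from $[0,T]$ to a metric space $(E,\rho)$ let $$V_p(f)=\sup\sum_{i=1}^n \frac{\rho(f(t_{i-1}),f(t_i))^p}{(t_i-t_{i-1})^{p-1}},$$ the supremum being over all partitions $0=t_0<t_1<\dots<t_n=T$, and let $BV_p(E)$ be the set of all $f$ with $V_p(f)<\infty$. For $A,B\in\mathrm{Conv}(\mathbb R^d)$ the Hukuhara difference $A\div B$ is the set $C\in \mathrm{Conv}(\mathbb R^d)$ with $A=B+C$, if it exists. A function $F:[0,T]\to\mathrm{Conv}(\mathbb R^d)$ is Hukuhara differentiable if for every $t\in[0,T]$ there is $D_H(F)(t)\in\mathrm{Conv}(\mathbb R^d)$ such that the limits of $h^{-1}(F(t+h)\div F(t))$ and $h^{-1}(F(t)\div F(t-h))$ as $h\to0+$ exist (the differences existing for all small $h>0$) and both equal $D_H(F)(t)$; at $t=0$ only the first and at $t=T$ only the second limit is required. For such an $F$ let $$\mathcal{IS}(F)=\{f\in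 BV_p(\mathbb R^d):\ f(t)\in F(t)\text{ for all }t\in[0,T],\ f'\in L^p([0,T],\mathbb R^d),\ f'(t)\in D_H(F)(t)\text{ for a.e. }t\}.$$ Let $B$ be the closed unit ball of $\mathbb R^d$, $V$ its volume, $\Sigma$ the unit sphere with surface measure $\omega$, and $\sigma(q,C)=\sup_{y\in C}\langle q,y\rangle$. For a probability measure $\mu$ on $B$ that has a $C^1$ density $\xi_\mu:B\to[0,\infty)$ with respect to normalized Lebesgue measure on $B$, the generalized Steiner center of $C\in\mathrm{Conv}(\mathbb R^d)$ is $$St_\mu(C)=V^{-1}\Big(\int_\Sigma q\,\sigma(q,C)\,\xi_\mu(q)\,d\omega(q)-\int_B\sigma(q,C)\,\nabla\xi_\mu(q)\,dq\Big).$$ **Theorem.** Let $F\in BV_p(\mathrm{Conv}(\mathbb R^d))$ be Hukuhara differentiable with $F(0)=\{x_0\}$, $x_0\in\mathbb R^d$. Then there is a Castaing representation $\{f_n\}_{n\ge1}$ of $F$, i.e. $F(t)=\overline{\{f_n(t):n\ge1\}}$ for every $t\in[0,T]$, with $f_n\in\mathcal{IS}(F)$ for every $n$. Moreover, the $f_n$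 can be chosen of the form $$f_n(t)=x_0+\int_0^t St_{\mu_n}(D_H(F)(s))\,ds,\qquad t\in[0,T],$$ with integrable integrands, where each $\mu_n$ is a probability measure on $B$ with a $C^1$ density with respect to normalized Lebesgue measure. -/

import Mathlib

open MeasureTheory Set Filter Topology
open scoped ENNReal

namespace SetValued

/-- `ℝ^d` with the Euclidean norm. -/
abbrev Rd (d : ℕ) : Type := EuclideanSpace ℝ (Fin d)

/-- `Conv(ℝ^d)`: nonempty compact convex subsets of `ℝ^d`. Mathlib's `ConvexBody` carries the
Hausdorff metric, Minkowski addition and scalar multiplication. -/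
abbrev Conv (d : ℕ) : Type := ConvexBody (Rd d)

/-- The Riesz `p`-variation of `f` on `[a, b]`, an element of `[0, ∞]`: the supremum over all
partitions `a = u 0 < u 1 < ⋯ < u n = b` of
`∑ i, d (f (u i), f (u (i + 1))) ^ p / (u (i + 1) - u i) ^ (p - 1)`. -/
noncomputable def rieszVariation {E : Type*} [PseudoMetricSpace E]
    (p : ℝ) (f : ℝ → E) (a b : ℝ) : ℝ≥0∞ :=
  ⨆ (n : ℕ) (u : Fin (n + 1) → ℝ) (_ : StrictMono u) (_ : u 0 = a) (_ : u (Fin.last n) = b),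
    ∑ i : Fin n, ENNReal.ofReal
      (dist (f (u i.castSucc)) (f (u i.succ)) ^ p / (u i.succ - u i.castSucc) ^ (p - 1))

/-- `f ∈ BV_p([0, T], E)`. Only the values of `f` on `[0, T]` matter. -/
def MemBV {E : Type*} [PseudoMetricSpace E] (T p : ℝ) (f : ℝ → E) : Prop :=
  rieszVariation p f 0 T < ∞

/-- The right Hukuhara derivative of `F` at `t` is `D`: for all small `h > 0` the Hukuhara
difference `C h = F (t + h) ÷ F t`, that is `F (t + h) = F t + C h`, exists, and
`h⁻¹ • C h → D` in the Hausdorff metric as `h → 0+`. -/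
def HasRightHukuharaDeriv {d : ℕ} (F : ℝ → Conv d) (D : Conv d) (t : ℝ) : Prop :=
  ∃ C : ℝ → Conv d, (∀ᶠ h in 𝓝[>] (0 : ℝ), F (t + h) = F t + C h) ∧
    Tendsto (fun h : ℝ => h⁻¹ • C h) (𝓝[>] (0 : ℝ)) (𝓝 D)

/-- The left Hukuhara derivative of `F` at `t` is `D`: for all small `h > 0` the Hukuhara
difference `C h = F t ÷ F (t - h)`, that is `F t = F (t - h) + C h`, exists, and
`h⁻¹ • C h → D` in the Hausdorff metric as `h → 0+`. -/
def HasLeftHukuharaDeriv {d : ℕ} (F : ℝ → Conv d) (D : Conv d) (t : ℝ) : Prop :=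
  ∃ C : ℝ → Conv d, (∀ᶠ h in 𝓝[>] (0 : ℝ), F t = F (t - h) + C h) ∧
    Tendsto (fun h : ℝ => h⁻¹ • C h) (𝓝[>] (0 : ℝ)) (𝓝 D)

/-- `D` is the Hukuhara differential at `t` of `F : [0, T] → Conv(ℝ^d)`: the two one-sided limits
exist and equal `D`; at the end points `0` and `T` only the limit from inside is required. -/
def HasHukuharaDeriv {d : ℕ} (T : ℝ) (F : ℝ → Conv d) (D : Conv d) (t : ℝ) : Prop :=
  (t < T → HasRightHukuharaDeriv F D t) ∧ (0 < t → HasLeftHukuharaDeriv F D t)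

/-- `F` is Hukuhara differentiable on `[0, T]`. -/
def HukuharaDifferentiable {d : ℕ} (T : ℝ) (F : ℝ → Conv d) : Prop :=
  ∀ t ∈ Icc (0 : ℝ) T, ∃ D : Conv d, HasHukuharaDeriv T F D t

open Classical in
/-- The Hukuhara derivative `D_H(F)` (with the junk value `{0}` where it does not exist). -/
noncomputable def hukuharaDeriv {d : ℕ} (T : ℝ) (F : ℝ → Conv d) (t : ℝ) : Conv d :=
  if h : ∃ D : Conv d, HasHukuharaDeriv T F D t then h.choose else 0

/-- `S_{L^p}(G)`: the `L^p` functions on `[0, T]` with `φ t ∈ G t` for a.e. `t`. -/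
def selectionsLp {d : ℕ} (T p : ℝ) (G : ℝ → Conv d) : Set (ℝ → Rd d) :=
  {φ | MemLp φ (ENNReal.ofReal p) (volume.restrict (Icc 0 T)) ∧
    ∀ᵐ t ∂(volume.restrict (Icc 0 T)), φ t ∈ G t}

/-- `S_{V_p}(F)`: the selections of `F` on `[0, T]` of bounded Riesz `p`-variation. -/
def selectionsBV {d : ℕ} (T p : ℝ) (F : ℝ → Conv d) : Set (ℝ → Rd d) :=
  {f | MemBV T p f ∧ ∀ t ∈ Icc (0 : ℝ) T, f t ∈ F t}

/-- `IS(F)`: all `f ∈ S_{V_p}(F)` whose (a.e. existing) derivative is in `S_{L^p}(D_H(F))`. -/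
def IS {d : ℕ} (T p : ℝ) (F : ℝ → Conv d) : Set (ℝ → Rd d) :=
  {f | f ∈ selectionsBV T p F ∧ ∃ φ ∈ selectionsLp T p (hukuharaDeriv T F),
    ∀ᵐ t ∂(volume.restrict (Icc 0 T)), HasDerivWithinAt f (φ t) (Icc 0 T) t}

/-- `(f n)` is a Castaing representation of `F : [0, T] → Conv(ℝ^d)`. -/
def IsCastaing {d : ℕ} (T : ℝ) (F : ℝ → Conv d) (f : ℕ → ℝ → Rd d) : Prop :=
  ∀ t ∈ Icc (0 : ℝ) T, (F t : Set (Rd d)) = closure (range fun n => f n t)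

/-- The support function `σ(q, C) = sup_{y ∈ C} ⟨q, y⟩`. -/
noncomputable def support {d : ℕ} (q : Rd d) (C : Conv d) : ℝ :=
  sSup ((fun y : Rd d => inner ℝ q y) '' (C : Set (Rd d)))

/-- The closed unit ball of `ℝ^d`. -/
abbrev unitBall (d : ℕ) : Set (Rd d) := Metric.closedBall 0 1

/-- `ξ` is the `C^1` density, with respect to normalized Lebesgue measure `p_V` on the closed
unit ball, of a probability measure `μ` on the ball. -/
structure IsSteinerDensity {d : ℕ} (ξ : Rd d → ℝ) : Prop where
  contDiffOn : ContDiffOn ℝ 1 ξ (unitBall d)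
  nonneg : ∀ q ∈ unitBall d, 0 ≤ ξ q
  integral_eq : (volume.real (unitBall d))⁻¹ * ∫ q in unitBall d, ξ q = 1

/-- The generalized Steiner center `St_μ(C)` of `C`, where `μ = ξ · p_V`, `V` is the volume of the
unit ball and `ω` the surface measure of the unit sphere:
`V⁻¹ (∫_Σ q σ(q, C) ξ(q) dω(q) - ∫_B σ(q, C) ∇ξ(q) dq)`. -/
noncomputable def steiner {d : ℕ} (ξ : Rd d → ℝ) (C : Conv d) : Rd d :=
  (volume.real (unitBall d))⁻¹ •
    ((∫ q : Metric.sphere (0 : Rd d) 1, (support (q : Rd d) C * ξ q) • (q : Rd d)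
        ∂((volume : Measure (Rd d)).toSphere)) -
      ∫ q in unitBall d, support q C • gradientWithin ξ (unitBall d) q)

end SetValued

namespace SetValued

variable {d : ℕ}

/-! ### Support functions of convex bodies -/

/-! For a density `ξ` vanishing on the sphere the surface term of the Steiner center drops out.
Integration by parts for the Lipschitz support function turns the rest into the `ξ`-weighted average
of the gradient of σ(·, C), whose values lie in C. So `steiner ξ` is additive, positively
homogeneous, Lipschitz, and selects a point of C (`steiner_mem`).

Additivity turns Hukuhara differences into differences, hence t ↦ St(F(t)) is differentiable with
derivative St(D_H F(t)). As a Lipschitz image of F it has finite Riesz `p`-variation, and Fatou's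
lemma puts its derivative in `L^p` (`lintegral_deriv_le_rieszVariation`). The fundamental theorem of
calculus then gives the integral formula, since the center of {x₀} is x₀.

Density of the selections (`exists_seq_closure_steiner_eq`): take countably many densities, closed
under averages, with one inside each small ball. The closure of the centers of C is stable under
midpoints, so a missed point of C would be separated from it in some direction v. A density
concentrated near a multiple of v almost maximizes ⟨v, ·⟩ over C (`le_inner_steiner`), a
contradiction. -/

theorem bddAbove_inner_image (q : Rd d) (C : Conv d) :
    BddAbove ((fun y : Rd d => inner ℝ q y) '' (C : Set (Rd d))) :=
  (C.isCompact.image (by fun_prop)).bddAbove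

theorem inner_le_support (q : Rd d) {C : Conv d} {y : Rd d} (hy : y ∈ (C : Set (Rd d))) :
    inner ℝ q y ≤ support q C :=
  le_csSup (bddAbove_inner_image q C) (mem_image_of_mem _ hy)

theorem support_le {q : Rd d} {C : Conv d} {a : ℝ}
    (h : ∀ y ∈ (C : Set (Rd d)), inner ℝ q y ≤ a) : support q C ≤ a :=
  csSup_le (C.nonempty.image _) (by rintro _ ⟨y, hy, rfl⟩; exact h y hy)

theorem exists_inner_eq_support (q : Rd d) (C : Conv d) :
    ∃ y ∈ (C : Set (Rd d)), inner ℝ q y = support q C := by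
  obtain ⟨y, hy, h⟩ := C.isCompact.exists_isMaxOn C.nonempty
    (f := fun y : Rd d => inner ℝ q y) (by fun_prop)
  exact ⟨y, hy, le_antisymm (inner_le_support q hy) (support_le fun z hz => h hz)⟩

theorem support_add (q : Rd d) (A B : Conv d) : support q (A + B) = support q A + support q B := by
  apply le_antisymm
  · refine support_le fun y hy => ?_
    obtain ⟨a, ha, b, hb, rfl⟩ := Set.mem_add.1 (by simpa using hy)
    rw [inner_add_right]
    exact add_le_add (inner_le_support q ha) (inner_le_support q hb)
  · obtain ⟨a, ha, h1⟩ := exists_inner_eq_support q A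
    obtain ⟨b, hb, h2⟩ := exists_inner_eq_support q B
    rw [← h1, ← h2, ← inner_add_right]
    exact inner_le_support q (by rw [ConvexBody.coe_add]; exact Set.add_mem_add ha hb)

theorem support_smul (q : Rd d) {c : ℝ} (hc : 0 ≤ c) (A : Conv d) :
    support q (c • A) = c * support q A := by
  apply le_antisymm
  · refine support_le fun y hy => ?_
    obtain ⟨a, ha, rfl⟩ := Set.mem_smul_set.1 (by simpa using hy)
    rw [real_inner_smul_right]
    exact mul_le_mul_of_nonneg_left (inner_le_support q ha) hc
  · obtain ⟨a, ha, h1⟩ := exists_inner_eq_support q A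
    rw [← h1, ← real_inner_smul_right]
    exact inner_le_support q (by rw [ConvexBody.coe_smul]; exact Set.smul_mem_smul_set ha)

theorem support_add_left_le (q r : Rd d) (C : Conv d) :
    support (q + r) C ≤ support q C + support r C :=
  support_le fun y hy => by
    rw [inner_add_left]
    exact add_le_add (inner_le_support q hy) (inner_le_support r hy)

theorem support_smul_left (q : Rd d) {c : ℝ} (hc : 0 ≤ c) (C : Conv d) :
    support (c • q) C = c * support q C := by
  apply le_antisymm
  · refine support_le fun y hy => ?_
    rw [real_inner_smul_left]
    exact mul_le_mul_of_nonneg_left (inner_le_support q hy) hc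
  · obtain ⟨a, ha, h1⟩ := exists_inner_eq_support q C
    rw [← h1, ← real_inner_smul_left]
    exact inner_le_support _ ha

theorem exists_norm_le (C : Conv d) : ∃ R : NNReal, ∀ y ∈ (C : Set (Rd d)), ‖y‖ ≤ R := by
  obtain ⟨R, hR⟩ := C.isCompact.isBounded.exists_norm_le
  exact ⟨R.toNNReal, fun y hy => (hR y hy).trans (Real.le_coe_toNNReal R)⟩

theorem support_le_norm_mul {C : Conv d} {R : ℝ} (hR : ∀ y ∈ (C : Set (Rd d)), ‖y‖ ≤ R)
    (q : Rd d) : support q C ≤ R * ‖q‖ :=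
  support_le fun y hy => (real_inner_le_norm q y).trans (by
    rw [mul_comm]; exact mul_le_mul_of_nonneg_right (hR y hy) (norm_nonneg q))

theorem lipschitzWith_support {C : Conv d} {R : NNReal}
    (hR : ∀ y ∈ (C : Set (Rd d)), ‖y‖ ≤ R) : LipschitzWith R fun q => support q C := by
  refine LipschitzWith.of_le_add_mul R fun q r => ?_
  calc support q C = support (r + (q - r)) C := by rw [add_sub_cancel]
    _ ≤ support r C + support (q - r) C := support_add_left_le _ _ _
    _ ≤ support r C + R * dist q r := by
      rw [dist_eq_norm]; exact add_le_add_right (support_le_norm_mul hR _) _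

theorem continuous_support (C : Conv d) : Continuous fun q => support q C := by
  obtain ⟨R, hR⟩ := exists_norm_le C
  exact (lipschitzWith_support hR).continuous

theorem support_le_add_dist (q : Rd d) (A B : Conv d) :
    support q A ≤ support q B + ‖q‖ * dist A B := by
  refine support_le fun y hy => ?_
  obtain ⟨z, hz, hyz⟩ := B.isCompact.exists_infDist_eq_dist B.nonempty y
  have h1 : dist y z ≤ dist A B := by
    rw [← hyz, ← ConvexBody.hausdorffDist_coe]
    exact Metric.infDist_le_hausdorffDist_of_mem hy ConvexBody.hausdorffEDist_ne_top
  calc inner ℝ q y = inner ℝ q z + inner ℝ q (y - z) := by rw [← inner_add_right, add_sub_cancel]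
    _ ≤ support q B + ‖q‖ * dist A B := by
      refine add_le_add (inner_le_support q hz) ((real_inner_le_norm _ _).trans ?_)
      rw [← dist_eq_norm]
      exact mul_le_mul_of_nonneg_left h1 (norm_nonneg q)

theorem abs_support_sub_le (q : Rd d) (A B : Conv d) :
    |support q A - support q B| ≤ ‖q‖ * dist A B := by
  rw [abs_sub_le_iff]
  have h1 := support_le_add_dist q A B
  have h2 := support_le_add_dist q B A
  rw [dist_comm] at h2
  constructor <;> linarith

theorem mem_of_forall_inner_le_support {C : Conv d} {x : Rd d}
    (h : ∀ q : Rd d, inner ℝ q x ≤ support q C) : x ∈ (C : Set (Rd d)) := by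
  by_contra hx
  obtain ⟨f, u, hfu, hu⟩ := geometric_hahn_banach_closed_point C.convex C.isClosed hx
  set q := (InnerProductSpace.toDual ℝ (Rd d)).symm f
  have hq : ∀ y, inner ℝ q y = f y := fun y => InnerProductSpace.toDual_symm_apply
  obtain ⟨y, hy, hyq⟩ := exists_inner_eq_support q C
  have h1 := h q
  rw [← hyq, hq, hq] at h1
  exact absurd (hfu y hy) (by linarith)

/-- Any line derivative of the support function is bounded by the support function of the
direction. -/
theorem lineDeriv_support_le {C : Conv d} {q v : Rd d}
    (h : LineDifferentiableAt ℝ (fun q => support q C) q v) :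
    lineDeriv ℝ (fun q => support q C) q v ≤ support v C := by
  refine le_of_tendsto h.hasLineDerivAt.tendsto_slope_zero_right ?_
  filter_upwards [self_mem_nhdsWithin] with t ht
  have ht : 0 < t := ht
  rw [smul_eq_mul, inv_mul_le_iff₀ ht, ← support_smul_left v ht.le]
  linarith [support_add_left_le q (t • v) C]

/-- Since q + tv + t(q - v) = (1 + t)q, sublinearity bounds the slope below by σ(q) - σ(q - v). Each
of σ(v) - σ(q) and σ(q - v) costs at most R‖q - v‖. -/
theorem le_lineDeriv_support {C : Conv d} {R : ℝ} (hR : ∀ y ∈ (C : Set (Rd d)), ‖y‖ ≤ R)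
    {q v : Rd d} (h : LineDifferentiableAt ℝ (fun q => support q C) q v) :
    support v C - 2 * R * ‖q - v‖ ≤ lineDeriv ℝ (fun q => support q C) q v := by
  have h3 : support v C ≤ support q C + R * ‖q - v‖ := by
    have := support_add_left_le q (v - q) C
    rw [add_sub_cancel] at this
    have h4 := support_le_norm_mul hR (v - q)
    rw [norm_sub_rev] at h4
    linarith
  refine ge_of_tendsto h.hasLineDerivAt.tendsto_slope_zero_right ?_
  filter_upwards [self_mem_nhdsWithin] with t ht
  have ht : 0 < t := ht
  rw [smul_eq_mul, le_inv_mul_iff₀ ht]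
  have h1 := support_add_left_le (q + t • v) (t • (q - v)) C
  rw [support_smul_left _ ht.le, show q + t • v + t • (q - v) = (1 + t) • q by module,
    support_smul_left _ (by linarith)] at h1
  have h2 := mul_le_mul_of_nonneg_left (support_le_norm_mul hR (q - v)) ht.le
  nlinarith [mul_le_mul_of_nonneg_left h3 ht.le]

/-! ### Steiner centers for densities supported in the open ball -/

/-- A `C^1` density on the whole space that vanishes outside the open unit ball. -/
structure IsInteriorDensity (ξ : Rd d → ℝ) : Prop where
  contDiff : ContDiff ℝ 1 ξ
  support_subset : Function.support ξ ⊆ Metric.ball 0 1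
  nonneg : ∀ q, 0 ≤ ξ q
  integral_eq : (volume.real (unitBall d))⁻¹ * ∫ q, ξ q = 1

theorem volume_unitBall_pos (d : ℕ) : 0 < volume.real (unitBall d) :=
  ENNReal.toReal_pos (Metric.measure_closedBall_pos _ _ one_pos).ne'
    measure_closedBall_lt_top.ne

namespace IsInteriorDensity

variable {ξ : Rd d → ℝ}

theorem tsupport_subset (h : IsInteriorDensity ξ) : tsupport ξ ⊆ unitBall d :=
  closure_minimal (h.support_subset.trans Metric.ball_subset_closedBall) Metric.isClosed_closedBall

theorem hasCompactSupport (h : IsInteriorDensity ξ) : HasCompactSupport ξ :=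
  (isCompact_closedBall _ _).of_isClosed_subset (isClosed_tsupport ξ) h.tsupport_subset

theorem continuous (h : IsInteriorDensity ξ) : Continuous ξ := h.contDiff.continuous

theorem differentiable (h : IsInteriorDensity ξ) : Differentiable ℝ ξ :=
  h.contDiff.differentiable one_ne_zero

theorem integrable (h : IsInteriorDensity ξ) : Integrable ξ :=
  h.continuous.integrable_of_hasCompactSupport h.hasCompactSupport

theorem continuous_gradient (h : IsInteriorDensity ξ) : Continuous (gradient ξ) :=
  (InnerProductSpace.toDual ℝ (Rd d)).symm.continuous.comp
    (h.contDiff.continuous_fderiv one_ne_zero)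

theorem tsupport_gradient_subset (h : IsInteriorDensity ξ) :
    tsupport (gradient ξ) ⊆ unitBall d := by
  refine (closure_minimal (fun q hq => ?_) (isClosed_tsupport ξ)).trans h.tsupport_subset
  apply support_fderiv_subset ℝ
  intro h0
  exact hq (by simp [gradient, h0])

theorem hasCompactSupport_gradient (h : IsInteriorDensity ξ) : HasCompactSupport (gradient ξ) :=
  (isCompact_closedBall _ _).of_isClosed_subset (isClosed_tsupport _) h.tsupport_gradient_subset

theorem isSteinerDensity (h : IsInteriorDensity ξ) : IsSteinerDensity ξ where
  contDiffOn := h.contDiff.contDiffOn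
  nonneg q _ := h.nonneg q
  integral_eq := by
    rw [setIntegral_eq_integral_of_forall_compl_eq_zero, h.integral_eq]
    intro q hq
    by_contra h0
    exact hq (Metric.ball_subset_closedBall (h.support_subset h0))

theorem eq_zero_of_norm_eq_one (h : IsInteriorDensity ξ) {q : Rd d} (hq : ‖q‖ = 1) : ξ q = 0 := by
  by_contra h0
  have := h.support_subset h0
  simp [hq] at this

theorem steiner_eq (h : IsInteriorDensity ξ) (C : Conv d) :
    steiner ξ C =
      -((volume.real (unitBall d))⁻¹ • ∫ q, support q C • gradient ξ q) := by
  have h1 : (∫ q : Metric.sphere (0 : Rd d) 1, (support (q : Rd d) C * ξ q) • (q : Rd d)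
        ∂((volume : Measure (Rd d)).toSphere)) = 0 := by
    refine integral_eq_zero_of_ae (.of_forall fun q => ?_)
    have hq : ξ (q : Rd d) = 0 := h.eq_zero_of_norm_eq_one (by simp)
    simp [hq]
  have h2 : (∫ q in unitBall d, support q C • gradientWithin ξ (unitBall d) q) =
      ∫ q, support q C • gradient ξ q := by
    rw [← setIntegral_eq_integral_of_forall_compl_eq_zero
      (s := unitBall d) (f := fun q => support q C • gradient ξ q)]
    · refine setIntegral_congr_fun Metric.isClosed_closedBall.measurableSet fun q hq => ?_
      have hu : UniqueDiffWithinAt ℝ (unitBall d) q :=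
        uniqueDiffOn_convex (convex_closedBall _ _)
          ⟨0, Metric.ball_subset_interior_closedBall (by simp)⟩ q hq
      simp only [gradientWithin, gradient, fderivWithin_eq_fderiv hu (h.differentiable q)]
    · intro q hq
      rw [image_eq_zero_of_notMem_tsupport fun hq' => hq (h.tsupport_gradient_subset hq'),
        smul_zero]
  rw [steiner, h1, h2, zero_sub, smul_neg]

theorem integrable_support_smul_gradient (h : IsInteriorDensity ξ) (C : Conv d) :
    Integrable fun q => support q C • gradient ξ q :=
  ((continuous_support C).smul h.continuous_gradient).integrable_of_hasCompactSupport
    (h.hasCompactSupport_gradient.smul_left)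

theorem steiner_add (h : IsInteriorDensity ξ) (A B : Conv d) :
    steiner ξ (A + B) = steiner ξ A + steiner ξ B := by
  simp only [h.steiner_eq, support_add, add_smul]
  rw [integral_add (h.integrable_support_smul_gradient A) (h.integrable_support_smul_gradient B),
    smul_add, neg_add]

theorem steiner_smul (h : IsInteriorDensity ξ) {c : ℝ} (hc : 0 ≤ c) (A : Conv d) :
    steiner ξ (c • A) = c • steiner ξ A := by
  simp only [h.steiner_eq, support_smul _ hc, mul_smul]
  rw [integral_smul, smul_neg, smul_comm]

/-- Used twice: to pass to the limit in Hukuhara quotients and to transfer finite `p`-variation from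
F to its selections. -/
theorem exists_lipschitzWith_steiner (h : IsInteriorDensity ξ) :
    ∃ K : NNReal, LipschitzWith K (steiner ξ) := by
  have hi : Integrable fun q => ‖q‖ * ‖gradient ξ q‖ :=
    (continuous_norm.mul h.continuous_gradient.norm).integrable_of_hasCompactSupport
      (h.hasCompactSupport_gradient.norm.mul_left)
  refine ⟨((volume.real (unitBall d))⁻¹ * ∫ q, ‖q‖ * ‖gradient ξ q‖).toNNReal,
    LipschitzWith.of_dist_le_mul fun A B => ?_⟩
  have hV := volume_unitBall_pos d
  rw [Real.coe_toNNReal _ (mul_nonneg (by positivity)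
    (integral_nonneg fun q => by positivity)), h.steiner_eq, h.steiner_eq, dist_neg_neg, dist_smul₀,
    Real.norm_of_nonneg (by positivity), mul_assoc]
  refine mul_le_mul_of_nonneg_left ?_ (by positivity)
  rw [dist_eq_norm, ← integral_sub (h.integrable_support_smul_gradient A)
    (h.integrable_support_smul_gradient B), ← integral_mul_const]
  refine norm_integral_le_of_norm_le (hi.mul_const _) (.of_forall fun q => ?_)
  rw [← sub_smul, norm_smul, Real.norm_eq_abs]
  calc _ ≤ (‖q‖ * dist A B) * ‖gradient ξ q‖ :=
        mul_le_mul_of_nonneg_right (abs_support_sub_le q A B) (norm_nonneg _)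
    _ = _ := by ring

/-- Integration by parts, the derivative passing from `ξ` to the support function; compact support
of `ξ` leaves no boundary term. -/
theorem inner_steiner (h : IsInteriorDensity ξ) (C : Conv d) (v : Rd d) :
    inner ℝ v (steiner ξ C) = (volume.real (unitBall d))⁻¹ *
      ∫ q, lineDeriv ℝ (fun q => support q C) q v * ξ q := by
  obtain ⟨R, hR⟩ := exists_norm_le C
  obtain ⟨K, hK⟩ := h.contDiff.lipschitzWith_of_hasCompactSupport h.hasCompactSupport one_ne_zero
  rw [LipschitzWith.integral_lineDeriv_mul_eq (lipschitzWith_support hR) hK h.hasCompactSupport,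
    h.steiner_eq, inner_neg_right, real_inner_smul_right,
    ← integral_inner (h.integrable_support_smul_gradient C), ← mul_neg, ← integral_neg]
  congr 2 with q
  rw [(h.differentiable q).lineDeriv_eq_fderiv, real_inner_smul_right, real_inner_comm,
    gradient, InnerProductSpace.toDual_symm_apply, map_neg]
  ring

theorem integrable_lineDeriv_mul (h : IsInteriorDensity ξ) (C : Conv d) (v : Rd d) :
    Integrable fun q => lineDeriv ℝ (fun q => support q C) q v * ξ q := by
  obtain ⟨R, hR⟩ := exists_norm_le C
  have hL := lipschitzWith_support hR
  refine h.integrable.bdd_mul (c := R * ‖v‖) ?_ (.of_forall fun q => ?_)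
  · exact (measurable_lineDeriv hL.continuous).aestronglyMeasurable
  · exact norm_lineDeriv_le_of_lipschitz ℝ hL

/-- A convex body is the intersection of its supporting half-spaces, and the averaged line
derivatives in direction v never exceed σ(v, C). -/
theorem steiner_mem (h : IsInteriorDensity ξ) (C : Conv d) :
    steiner ξ C ∈ (C : Set (Rd d)) := by
  obtain ⟨R, hR⟩ := exists_norm_le C
  refine mem_of_forall_inner_le_support fun v => ?_
  have hV := volume_unitBall_pos d
  calc inner ℝ v (steiner ξ C) = (volume.real (unitBall d))⁻¹ *
        ∫ q, lineDeriv ℝ (fun q => support q C) q v * ξ q := h.inner_steiner C v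
    _ ≤ (volume.real (unitBall d))⁻¹ * ∫ q, support v C * ξ q := by
      refine mul_le_mul_of_nonneg_left ?_ (by positivity)
      refine integral_mono_ae (h.integrable_lineDeriv_mul C v) (h.integrable.const_mul _) ?_
      filter_upwards [(lipschitzWith_support hR).ae_lineDifferentiableAt v] with q hq
      exact mul_le_mul_of_nonneg_right (lineDeriv_support_le hq) (h.nonneg q)
    _ = support v C := by rw [integral_const_mul, mul_left_comm, h.integral_eq, mul_one]

/-- A density concentrated near `v` has a Steiner center almost maximizing `⟨v, ·⟩`. -/
theorem le_inner_steiner (h : IsInteriorDensity ξ) {C : Conv d} {R : NNReal}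
    (hR : ∀ y ∈ (C : Set (Rd d)), ‖y‖ ≤ R) {v : Rd d} {r : ℝ}
    (hξ : Function.support ξ ⊆ Metric.ball v r) :
    support v C - 2 * R * r ≤ inner ℝ v (steiner ξ C) := by
  have hV := volume_unitBall_pos d
  calc support v C - 2 * R * r
      = (volume.real (unitBall d))⁻¹ * ∫ q, (support v C - 2 * R * r) * ξ q := by
        rw [integral_const_mul, mul_left_comm, h.integral_eq, mul_one]
    _ ≤ (volume.real (unitBall d))⁻¹ *
        ∫ q, lineDeriv ℝ (fun q => support q C) q v * ξ q := by
      refine mul_le_mul_of_nonneg_left ?_ (by positivity)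
      refine integral_mono_ae (h.integrable.const_mul _) (h.integrable_lineDeriv_mul C v) ?_
      filter_upwards [(lipschitzWith_support hR).ae_lineDifferentiableAt v] with q hq
      by_cases h0 : ξ q = 0
      · simp [h0]
      · refine mul_le_mul_of_nonneg_right ?_ (h.nonneg q)
        have h1 : ‖q - v‖ ≤ r := by
          rw [← dist_eq_norm]; exact (Metric.mem_ball.1 (hξ h0)).le
        have h2 := mul_le_mul_of_nonneg_left h1 (show 0 ≤ 2 * (R : ℝ) by positivity)
        linarith [le_lineDeriv_support hR hq]
    _ = inner ℝ v (steiner ξ C) := (h.inner_steiner C v).symm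

/-! ### Averages of densities, which give midpoints of Steiner centers -/

theorem gradient_half_add {ξ η : Rd d → ℝ} (h : IsInteriorDensity ξ) (h' : IsInteriorDensity η)
    (q : Rd d) : gradient (fun q => (ξ q + η q) / 2) q =
      (1 / 2 : ℝ) • (gradient ξ q + gradient η q) := by
  have h1 := (((h.differentiable q).hasFDerivAt.add
    (h'.differentiable q).hasFDerivAt).const_smul (1 / 2 : ℝ)).fderiv
  have h2 : (fun q => (ξ q + η q) / 2) = (1 / 2 : ℝ) • (ξ + η) := by
    ext q; simp; ring
  rw [h2, gradient, h1]
  simp [gradient]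

theorem half_add {ξ η : Rd d → ℝ} (h : IsInteriorDensity ξ) (h' : IsInteriorDensity η) :
    IsInteriorDensity fun q => (ξ q + η q) / 2 where
  contDiff := (h.contDiff.add h'.contDiff).div_const 2
  support_subset q hq := by
    by_contra h0
    have h1 : ξ q = 0 := by by_contra h2; exact h0 (h.support_subset h2)
    have h2 : η q = 0 := by by_contra h2; exact h0 (h'.support_subset h2)
    exact hq (by simp [h1, h2])
  nonneg q := by have := h.nonneg q; have := h'.nonneg q; positivity
  integral_eq := by
    rw [integral_div, integral_add h.integrable h'.integrable, mul_div_assoc', mul_add,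
      h.integral_eq, h'.integral_eq]
    norm_num

theorem steiner_half_add {ξ η : Rd d → ℝ} (h : IsInteriorDensity ξ) (h' : IsInteriorDensity η)
    (C : Conv d) : steiner (fun q => (ξ q + η q) / 2) C =
      (1 / 2 : ℝ) • (steiner ξ C + steiner η C) := by
  have h1 : Integrable fun q => (1 / 2 : ℝ) • support q C • gradient ξ q :=
    (h.integrable_support_smul_gradient C).smul (1 / 2 : ℝ)
  have h2 : Integrable fun q => (1 / 2 : ℝ) • support q C • gradient η q :=
    (h'.integrable_support_smul_gradient C).smul (1 / 2 : ℝ)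
  simp only [(h.half_add h').steiner_eq, h.steiner_eq, h'.steiner_eq, gradient_half_add h h',
    smul_comm _ (1 / 2 : ℝ), smul_add]
  rw [integral_add h1 h2, integral_smul,
    integral_smul]
  module

end IsInteriorDensity

/-- Densities supported in arbitrarily small balls exist. -/
theorem exists_isInteriorDensity_support_subset (c : Rd d) {r : ℝ} (hr : 0 < r)
    (h : Metric.ball c r ⊆ Metric.ball 0 1) :
    ∃ ξ : Rd d → ℝ, IsInteriorDensity ξ ∧ Function.support ξ ⊆ Metric.ball c r := by
  let φ : ContDiffBump c := ⟨r / 2, r, by positivity, by linarith⟩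
  have hV := volume_unitBall_pos d
  have hs : Function.support (fun q => volume.real (unitBall d) * φ.normed volume q) ⊆
      Metric.ball c r := fun q hq => by
    rw [show r = φ.rOut from rfl, ← φ.support_normed_eq (μ := volume)]
    exact right_ne_zero_of_mul hq
  refine ⟨fun q => volume.real (unitBall d) * φ.normed volume q, ⟨?_, ?_, ?_, ?_⟩, hs⟩
  · exact contDiff_const.mul φ.contDiff_normed
  · exact hs.trans h
  · exact fun q => mul_nonneg hV.le (φ.nonneg_normed q)
  · rw [integral_const_mul, φ.integral_normed, mul_one, inv_mul_cancel₀ hV.ne']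

/-! ### A countable family of densities whose Steiner centers are dense -/

/-- A countable set has a countable superset closed under a binary operation. -/
theorem exists_countable_superset_closed {X : Type*} (op : X → X → X) {P : X → Prop} {S : Set X}
    (hS : S.Countable) (hP : ∀ x ∈ S, P x) (hop : ∀ x y, P x → P y → P (op x y)) :
    ∃ S' : Set X, S'.Countable ∧ S ⊆ S' ∧ (∀ x ∈ S', P x) ∧
      ∀ x ∈ S', ∀ y ∈ S', op x y ∈ S' := by
  let L : ℕ → Set X := fun n => n.rec S fun _ A => A ∪ image2 op A A
  have hL : ∀ n, L (n + 1) = L n ∪ image2 op (L n) (L n) := fun n => rfl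
  have hmono : Monotone L := monotone_nat_of_le_succ fun n => by
    rw [hL]; exact subset_union_left
  refine ⟨⋃ n, L n, countable_iUnion fun n => ?_, subset_iUnion L 0, fun x hx => ?_,
    fun x hx y hy => ?_⟩
  · induction n with
    | zero => exact hS
    | succ n ih => rw [hL]; exact ih.union (ih.image2 ih op)
  · obtain ⟨n, hn⟩ := mem_iUnion.1 hx
    clear hx
    induction n generalizing x with
    | zero => exact hP x hn
    | succ n ih =>
      rw [hL] at hn
      rcases hn with hn | ⟨a, ha, b, hb, rfl⟩
      · exact ih x hn
      · exact hop a b (ih a ha) (ih b hb)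
  · obtain ⟨m, hm⟩ := mem_iUnion.1 hx
    obtain ⟨n, hn⟩ := mem_iUnion.1 hy
    refine mem_iUnion.2 ⟨max m n + 1, ?_⟩
    rw [hL]
    exact .inr ⟨x, hmono (le_max_left m n) hm, y, hmono (le_max_right m n) hn, rfl⟩

/-- The nearest point separates a point from a closed set that is stable under midpoints. -/
theorem exists_inner_le_of_midpoint_closed {K : Set (Rd d)} (hK : IsClosed K)
    (hne : K.Nonempty) (hmid : ∀ y ∈ K, ∀ z ∈ K, (1 / 2 : ℝ) • (y + z) ∈ K)
    {x : Rd d} (hx : x ∉ K) :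
    ∃ v : Rd d, v ≠ 0 ∧ ∀ z ∈ K, inner ℝ v z ≤ inner ℝ v x - ‖v‖ ^ 2 := by
  obtain ⟨y, hy, hxy⟩ := hK.exists_infDist_eq_dist hne x
  refine ⟨x - y, fun h => hx (by rwa [sub_eq_zero.1 h]), fun z hz => ?_⟩
  -- Repeated midpoints approach y along the segment to z, which is all of convexity that the
  -- variational inequality at the nearest point needs.
  have hmem : ∀ k : ℕ, y + (1 / 2 : ℝ) ^ k • (z - y) ∈ K := by
    intro k
    induction k with
    | zero => simpa using hz
    | succ k ih =>
      convert hmid y hy _ ih using 1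
      rw [pow_succ]
      module
  have hle : ∀ k : ℕ, 2 * inner ℝ (x - y) (z - y) ≤ (1 / 2 : ℝ) ^ k * ‖z - y‖ ^ 2 := by
    intro k
    have h1 : ‖x - y‖ ≤ ‖(x - y) - (1 / 2 : ℝ) ^ k • (z - y)‖ := by
      rw [sub_sub, ← dist_eq_norm, ← dist_eq_norm, ← hxy]
      exact Metric.infDist_le_dist_of_mem (hmem k)
    have hk : 0 < (1 / 2 : ℝ) ^ k := by positivity
    have h2 := pow_le_pow_left₀ (norm_nonneg _) h1 2
    rw [norm_sub_sq_real (x - y), real_inner_smul_right, norm_smul, Real.norm_of_nonneg hk.le] at h2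
    refine le_of_mul_le_mul_left ?_ hk
    nlinarith
  have hlim : Tendsto (fun k : ℕ => (1 / 2 : ℝ) ^ k * ‖z - y‖ ^ 2) atTop (𝓝 (0 * ‖z - y‖ ^ 2)) :=
    (tendsto_pow_atTop_nhds_zero_of_lt_one (by norm_num) (by norm_num)).mul_const _
  have h3 := ge_of_tendsto' hlim hle
  rw [zero_mul, show z - y = (z - x) + (x - y) by abel, inner_add_right,
    real_inner_self_eq_norm_sq, inner_sub_right] at h3
  linarith

/-- There are countably many densities such that every open ball inside the unit ball supports one
of them, and the family is stable under averages. -/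
theorem exists_countable_densities (d : ℕ) :
    ∃ S : Set (Rd d → ℝ), S.Countable ∧ (∀ ξ ∈ S, IsInteriorDensity ξ) ∧
      (∀ ξ ∈ S, ∀ η ∈ S, (fun q => (ξ q + η q) / 2) ∈ S) ∧
      ∀ (c : Rd d) (r : ℝ), 0 < r → Metric.ball c r ⊆ Metric.ball 0 1 →
        ∃ ξ ∈ S, Function.support ξ ⊆ Metric.ball c r := by
  choose! g hg using fun (c : Rd d) (r : ℝ) (hr : 0 < r ∧ Metric.ball c r ⊆ Metric.ball 0 1) =>
    exists_isInteriorDensity_support_subset c hr.1 hr.2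
  obtain ⟨S, hS, hsub, hP, hop⟩ := exists_countable_superset_closed
    (fun ξ η : Rd d → ℝ => fun q => (ξ q + η q) / 2) (P := IsInteriorDensity)
    -- `g` takes arbitrary values where the ball is not inside the unit ball; the intersection
    -- discards those that are not densities.
    (S := range (fun i : ℕ × ℕ => g (TopologicalSpace.denseSeq (Rd d) i.1) (1 / (i.2 + 1))) ∩
      {ξ | IsInteriorDensity ξ})
    ((countable_range _).mono inter_subset_left) (fun ξ hξ => hξ.2)
    (fun ξ η hξ hη => hξ.half_add hη)
  refine ⟨S, hS, hP, hop, fun c r hr hc => ?_⟩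
  obtain ⟨m, hm⟩ := exists_nat_one_div_lt (half_pos hr)
  have hm0 : (0 : ℝ) < 1 / (m + 1) := Nat.one_div_pos_of_nat
  obtain ⟨k, hk⟩ := (TopologicalSpace.denseRange_denseSeq (Rd d)).exists_dist_lt c hm0
  have hb : Metric.ball (TopologicalSpace.denseSeq (Rd d) k) (1 / ((m : ℝ) + 1)) ⊆
      Metric.ball c r := Metric.ball_subset_ball' (by rw [dist_comm]; linarith)
  obtain ⟨h1, h2⟩ := hg _ _ ⟨hm0, hb.trans hc⟩
  exact ⟨_, hsub ⟨⟨(k, m), rfl⟩, h1⟩, h2.trans hb⟩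

theorem exists_seq_closure_steiner_eq (d : ℕ) :
    ∃ ξ : ℕ → Rd d → ℝ, (∀ n, IsInteriorDensity (ξ n)) ∧
      ∀ C : Conv d, (C : Set (Rd d)) = closure (range fun n => steiner (ξ n) C) := by
  obtain ⟨S, hS, hP, hop, hball⟩ := exists_countable_densities d
  obtain ⟨ξ₀, hξ₀, -⟩ := hball 0 1 one_pos subset_rfl
  obtain ⟨ξ, rfl⟩ := hS.exists_eq_range ⟨ξ₀, hξ₀⟩
  have hξ : ∀ n, IsInteriorDensity (ξ n) := fun n => hP _ (mem_range_self n)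
  refine ⟨ξ, hξ, fun C => subset_antisymm (fun x hx => ?_) (closure_minimal ?_ C.isClosed)⟩
  swap
  · rintro _ ⟨n, rfl⟩
    exact (hξ n).steiner_mem C
  by_contra hxK
  obtain ⟨v, hv, hvK⟩ := exists_inner_le_of_midpoint_closed isClosed_closure
    (range_nonempty _).closure (fun y hy z hz => by
      refine map_mem_closure₂ (f := fun y z : Rd d => (1 / 2 : ℝ) • (y + z)) (by fun_prop)
        hy hz ?_
      rintro _ ⟨m, rfl⟩ _ ⟨n, rfl⟩
      obtain ⟨k, hk⟩ := hop _ (mem_range_self m) _ (mem_range_self n)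
      exact ⟨k, by rw [← (hξ m).steiner_half_add (hξ n), ← hk]⟩) hxK
  obtain ⟨R, hR⟩ := exists_norm_le C
  have hv0 : 0 < ‖v‖ := norm_pos_iff.2 hv
  have hR0 : (0 : ℝ) ≤ R := R.2
  -- The center s • v below has norm 1/2, so r ≤ 1/2 keeps the ball inside the unit ball. The second
  -- bound makes the loss 2Rr smaller than the separation gap s‖v‖² = ‖v‖/2.
  obtain ⟨r, hr0, hr1, hr2⟩ : ∃ r : ℝ, 0 < r ∧ r ≤ 1 / 2 ∧ r * (8 * (R + 1)) ≤ ‖v‖ :=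
    ⟨min (1 / 2) (‖v‖ / (8 * (R + 1))), lt_min (by norm_num) (by positivity), min_le_left _ _,
      (le_div_iff₀ (by positivity)).1 (min_le_right _ _)⟩
  set s : ℝ := 1 / (2 * ‖v‖) with hs
  have hs0 : 0 < s := by positivity
  have hsv : s * ‖v‖ = 1 / 2 := by rw [hs]; field_simp
  obtain ⟨_, ⟨n, rfl⟩, hn⟩ := hball (s • v) r hr0 (Metric.ball_subset_ball' (by
    rw [dist_zero_right, norm_smul, Real.norm_of_nonneg hs0.le, hsv]; linarith))
  have h1 := (hξ n).le_inner_steiner hR hn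
  have h2 := inner_le_support (s • v) hx
  have h3 := mul_le_mul_of_nonneg_left (hvK _ (subset_closure (mem_range_self n))) hs0.le
  rw [real_inner_smul_left] at h1 h2
  have h4 : s * ‖v‖ ^ 2 = ‖v‖ / 2 := by rw [pow_two, ← mul_assoc, hsv]; ring
  nlinarith

/-! ### Hukuhara derivatives and Steiner centers -/

section Derivative

variable {ξ : Rd d → ℝ} {F : ℝ → Conv d} {D : Conv d} {T t : ℝ}

/-- Continuity of the center in the Hausdorff metric, with homogeneity moving h⁻¹ outside. -/
theorem IsInteriorDensity.tendsto_inv_smul_steiner (h : IsInteriorDensity ξ) {C : ℝ → Conv d}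
    (hC : Tendsto (fun h : ℝ => h⁻¹ • C h) (𝓝[>] (0 : ℝ)) (𝓝 D)) :
    Tendsto (fun h : ℝ => h⁻¹ • steiner ξ (C h)) (𝓝[>] (0 : ℝ)) (𝓝 (steiner ξ D)) := by
  obtain ⟨K, hK⟩ := h.exists_lipschitzWith_steiner
  refine ((hK.continuous.tendsto D).comp hC).congr' ?_
  filter_upwards [self_mem_nhdsWithin] with s hs
  exact h.steiner_smul (inv_nonneg.2 (le_of_lt hs)) _

theorem HasRightHukuharaDeriv.hasDerivWithinAt_steiner (hF : HasRightHukuharaDeriv F D t)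
    (h : IsInteriorDensity ξ) :
    HasDerivWithinAt (fun s => steiner ξ (F s)) (steiner ξ D) (Ioi t) t := by
  obtain ⟨C, hFC, hC⟩ := hF
  rw [hasDerivWithinAt_iff_tendsto_slope' (by simp)]
  have hs : Tendsto (fun s => s - t) (𝓝[>] t) (𝓝[>] 0) := by
    refine tendsto_nhdsWithin_iff.2 ⟨?_, ?_⟩
    · exact ((continuous_id.sub continuous_const).tendsto' t 0 (sub_self t)).mono_left
        nhdsWithin_le_nhds
    · filter_upwards [self_mem_nhdsWithin] with s hs using sub_pos.2 (mem_Ioi.1 hs)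
  refine ((h.tendsto_inv_smul_steiner hC).comp hs).congr' ?_
  filter_upwards [hs.eventually hFC] with s hs
  rw [add_sub_cancel] at hs
  simp [slope, hs, h.steiner_add]

theorem HasLeftHukuharaDeriv.hasDerivWithinAt_steiner (hF : HasLeftHukuharaDeriv F D t)
    (h : IsInteriorDensity ξ) :
    HasDerivWithinAt (fun s => steiner ξ (F s)) (steiner ξ D) (Iio t) t := by
  obtain ⟨C, hFC, hC⟩ := hF
  rw [hasDerivWithinAt_iff_tendsto_slope' (by simp)]
  have hs : Tendsto (fun s => t - s) (𝓝[<] t) (𝓝[>] 0) := by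
    refine tendsto_nhdsWithin_iff.2 ⟨?_, ?_⟩
    · exact (Continuous.tendsto' (by fun_prop) t 0 (sub_self t)).mono_left nhdsWithin_le_nhds
    · filter_upwards [self_mem_nhdsWithin] with s hs using sub_pos.2 (mem_Iio.1 hs)
  refine ((h.tendsto_inv_smul_steiner hC).comp hs).congr' ?_
  filter_upwards [hs.eventually hFC] with s hs
  rw [sub_sub_cancel] at hs
  rw [slope_comm]
  simp [slope, hs, h.steiner_add]

theorem HasHukuharaDeriv.hasDerivWithinAt_steiner (hF : HasHukuharaDeriv T F D t)
    (h : IsInteriorDensity ξ) (ht : t ∈ Icc 0 T) :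
    HasDerivWithinAt (fun s => steiner ξ (F s)) (steiner ξ D) (Icc 0 T) t := by
  have h1 : HasDerivWithinAt (fun s => steiner ξ (F s)) (steiner ξ D) (Icc t T) t := by
    rcases ht.2.lt_or_eq with h1 | rfl
    · exact ((hF.1 h1).hasDerivWithinAt_steiner h).Ici_of_Ioi.mono Icc_subset_Ici_self
    -- At the end point the interval is a single point, where any derivative is admissible.
    · exact HasFDerivWithinAt.of_subsingleton (by simp)
  have h2 : HasDerivWithinAt (fun s => steiner ξ (F s)) (steiner ξ D) (Icc 0 t) t := by
    rcases ht.1.lt_or_eq with h2 | rfl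
    · exact ((hF.2 h2).hasDerivWithinAt_steiner h).Iic_of_Iio.mono Icc_subset_Iic_self
    · exact HasFDerivWithinAt.of_subsingleton (by simp)
  simpa [Icc_union_Icc_eq_Icc ht.1 ht.2] using h2.union h1

theorem HukuharaDifferentiable.hasHukuharaDeriv (hF : HukuharaDifferentiable T F)
    (ht : t ∈ Icc 0 T) : HasHukuharaDeriv T F (hukuharaDeriv T F t) t := by
  have h := hF t ht
  rw [hukuharaDeriv, dif_pos h]
  exact h.choose_spec

end Derivative

/-! ### Riesz `p`-variation -/

section Variation

theorem sum_le_rieszVariation {E : Type*} [PseudoMetricSpace E] (p : ℝ) (f : ℝ → E) (a b : ℝ)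
    {n : ℕ} {u : Fin (n + 1) → ℝ} (hu : StrictMono u) (h0 : u 0 = a) (hn : u (Fin.last n) = b) :
    ∑ i : Fin n, ENNReal.ofReal
      (dist (f (u i.castSucc)) (f (u i.succ)) ^ p / (u i.succ - u i.castSucc) ^ (p - 1)) ≤
      rieszVariation p f a b :=
  le_iSup_of_le n <| le_iSup_of_le u <| le_iSup_of_le hu <| le_iSup_of_le h0 <|
    le_iSup_of_le hn le_rfl

theorem MemBV.comp_lipschitzWith {E E' : Type*} [PseudoMetricSpace E] [PseudoMetricSpace E']
    {T p : ℝ} {f : ℝ → E} {g : E → E'} {K : NNReal} (hp : 0 ≤ p) (hg : LipschitzWith K g)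
    (hf : MemBV T p f) : MemBV T p fun t => g (f t) := by
  refine lt_of_le_of_lt (b := ENNReal.ofReal ((K : ℝ) ^ p) * rieszVariation p f 0 T) ?_
    (ENNReal.mul_lt_top ENNReal.ofReal_lt_top hf)
  refine iSup_le fun n => iSup_le fun u => iSup_le fun hu => iSup_le fun h0 => iSup_le fun hn =>
    le_trans ?_ (mul_le_mul_right (sum_le_rieszVariation p f 0 T hu h0 hn) _)
  rw [Finset.mul_sum]
  refine Finset.sum_le_sum fun i _ => ?_
  have hi : 0 < u i.succ - u i.castSucc := sub_pos.2 (hu i.castSucc_lt_succ)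
  rw [← ENNReal.ofReal_mul (by positivity), mul_div_assoc', ← Real.mul_rpow K.coe_nonneg dist_nonneg]
  gcongr
  exact hg.dist_le_mul _ _

variable {E : Type*} [NormedAddCommGroup E]

/-- The sum defining the Riesz `p`-variation for the partition of `[0, T]` into equal parts. -/
theorem sum_uniform_le_rieszVariation {T : ℝ} (hT : 0 < T) (p : ℝ) (f : ℝ → E) (n : ℕ) :
    ∑ i : Fin (n + 1), ENNReal.ofReal
      (‖f ((i + 1) * (T / (n + 1))) - f (i * (T / (n + 1)))‖ ^ p / (T / (n + 1)) ^ (p - 1)) ≤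
      rieszVariation p f 0 T := by
  have hδ : 0 < T / ((n : ℝ) + 1) := by positivity
  refine le_trans (Finset.sum_le_sum fun i _ => le_of_eq ?_) (sum_le_rieszVariation p f 0 T
    (u := fun i : Fin (n + 1 + 1) => ((i : ℕ) : ℝ) * (T / ((n : ℝ) + 1))) (fun i j hij => ?_)
    ?_ ?_)
  · simp only [Fin.val_succ, Fin.val_castSucc, Nat.cast_add, Nat.cast_one]
    rw [dist_comm, dist_eq_norm, ← sub_mul, add_sub_cancel_left, one_mul]
  · exact mul_lt_mul_of_pos_right (by exact_mod_cast hij) hδ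
  · simp
  · simp only [Fin.val_last, Nat.cast_add, Nat.cast_one]
    field_simp

variable [NormedSpace ℝ E]

/-- Difference quotients over intervals that shrink to a point they contain. -/
theorem tendsto_slope_of_mem_Icc {f : ℝ → E} {f' : E} {t : ℝ}
    (h : HasDerivAt f f' t) {a b : ℕ → ℝ} (ha : Tendsto a atTop (𝓝 t)) (hb : Tendsto b atTop (𝓝 t))
    (hat : ∀ n, a n ≤ t) (htb : ∀ n, t ≤ b n) (hab : ∀ n, a n < b n) :
    Tendsto (fun n => (b n - a n)⁻¹ • (f (b n) - f (a n))) atTop (𝓝 f') := by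
  rw [Metric.tendsto_nhds]
  intro ε hε
  have h1 := (hasDerivAt_iff_isLittleO.1 h).def (half_pos hε)
  filter_upwards [ha.eventually h1, hb.eventually h1] with n h2 h3
  have hn : 0 < b n - a n := sub_pos.2 (hab n)
  rw [Real.norm_eq_abs, abs_of_nonpos (by linarith [hat n])] at h2
  rw [Real.norm_eq_abs, abs_of_nonneg (by linarith [htb n])] at h3
  -- Splitting at t, the two errors are at most (ε/2)(b - t) and (ε/2)(t - a), adding up to (ε/2)(b
  -- - a).
  have h4 : (b n - a n)⁻¹ • (f (b n) - f (a n)) - f' = (b n - a n)⁻¹ •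
      ((f (b n) - f t - (b n - t) • f') - (f (a n) - f t - (a n - t) • f')) := by
    rw [eq_inv_smul_iff₀ hn.ne', smul_sub, smul_inv_smul₀ hn.ne']
    module
  rw [dist_eq_norm, h4, norm_smul, norm_inv, Real.norm_of_nonneg hn.le, inv_mul_lt_iff₀ hn]
  have h5 := norm_sub_le (f (b n) - f t - (b n - t) • f') (f (a n) - f t - (a n - t) • f')
  nlinarith

/-- The integrand is constant on each cell of length δ, and δ‖Δf/δ‖^p = ‖Δf‖^p / δ^(p-1) is a term
of the Riesz sum. -/
theorem lintegral_uniform_slope_le {T p : ℝ} (hT : 0 < T) (hp : 0 ≤ p) (f : ℝ → E) (n : ℕ) :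
    ∫⁻ t in Ioo 0 T, ‖(T / ((n : ℝ) + 1))⁻¹ •
      (f ((⌊t / (T / ((n : ℝ) + 1))⌋₊ + 1) * (T / ((n : ℝ) + 1))) -
        f (⌊t / (T / ((n : ℝ) + 1))⌋₊ * (T / ((n : ℝ) + 1))))‖ₑ ^ p ≤ rieszVariation p f 0 T := by
  refine le_trans ?_ (sum_uniform_le_rieszVariation hT p f n)
  have hNδ : ((n : ℝ) + 1) * (T / ((n : ℝ) + 1)) = T := by field_simp
  have hδ : 0 < T / ((n : ℝ) + 1) := by positivity
  generalize T / ((n : ℝ) + 1) = δ at hδ hNδ ⊢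
  have hsub : Ioo 0 T ⊆ ⋃ i : Fin (n + 1), Ico ((i : ℝ) * δ) ((i + 1) * δ) := by
    intro t ht
    have h1 : ⌊t / δ⌋₊ < n + 1 := by
      rw [Nat.floor_lt (div_nonneg ht.1.le hδ.le), div_lt_iff₀ hδ]
      push_cast
      linarith [ht.2]
    refine mem_iUnion.2 ⟨⟨_, h1⟩, ?_, ?_⟩
    · exact (le_div_iff₀ hδ).1 (Nat.floor_le (div_nonneg ht.1.le hδ.le))
    · exact (div_lt_iff₀ hδ).1 (Nat.lt_floor_add_one _)
  refine (lintegral_mono_set hsub).trans ((lintegral_iUnion_le _ _).trans ?_)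
  rw [tsum_fintype]
  refine Finset.sum_le_sum fun i _ => le_of_eq ?_
  have hfl : ∀ t ∈ Ico ((i : ℝ) * δ) ((i + 1) * δ), ⌊t / δ⌋₊ = (i : ℕ) := fun t ht => by
    have ht0 : 0 ≤ t := le_trans (by positivity) ht.1
    rw [Nat.floor_eq_iff (div_nonneg ht0 hδ.le), le_div_iff₀ hδ, div_lt_iff₀ hδ]
    exact ht
  rw [setLIntegral_congr_fun (g := fun _ => ‖δ⁻¹ • (f ((i + 1) * δ) - f (i * δ))‖ₑ ^ p)
    measurableSet_Ico (fun t ht => by simp only [hfl t ht]), setLIntegral_const, Real.volume_Ico, ← sub_mul, add_sub_cancel_left, one_mul,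
    ← ofReal_norm, ENNReal.ofReal_rpow_of_nonneg (norm_nonneg _) hp,
    ← ENNReal.ofReal_mul (by positivity), norm_smul, norm_inv, Real.norm_of_nonneg hδ.le,
    Real.mul_rpow (by positivity) (norm_nonneg _), Real.inv_rpow hδ.le, Real.rpow_sub_one hδ.ne']
  congr 1
  field_simp

/-- An everywhere differentiable function of finite Riesz `p`-variation has its derivative in
`L^p`. -/
theorem lintegral_deriv_le_rieszVariation [CompleteSpace E] {T p : ℝ} (hT : 0 < T) (hp : 0 ≤ p)
    {f : ℝ → E} (hf : ∀ t ∈ Ioo 0 T, DifferentiableAt ℝ f t) :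
    ∫⁻ t in Ioo 0 T, ‖deriv f t‖ₑ ^ p ≤ rieszVariation p f 0 T := by
  -- Slopes of f over the cell containing t; they converge to the derivative, so Fatou's lemma
  -- applies.
  set g : ℕ → ℝ → E := fun n t => (T / ((n : ℝ) + 1))⁻¹ •
      (f ((⌊t / (T / ((n : ℝ) + 1))⌋₊ + 1) * (T / ((n : ℝ) + 1))) -
        f (⌊t / (T / ((n : ℝ) + 1))⌋₊ * (T / ((n : ℝ) + 1)))) with hg
  have hδ0 : Tendsto (fun n : ℕ => T / ((n : ℝ) + 1)) atTop (𝓝 0) :=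
    tendsto_const_nhds.div_atTop
      (tendsto_atTop_add_const_right _ _ tendsto_natCast_atTop_atTop)
  have hlim : ∀ t ∈ Ioo 0 T, Tendsto (fun n => g n t) atTop (𝓝 (deriv f t)) := by
    intro t ht
    have hδ : ∀ n : ℕ, 0 < T / ((n : ℝ) + 1) := fun n => by positivity
    have hle : ∀ n : ℕ, ⌊t / (T / ((n : ℝ) + 1))⌋₊ * (T / ((n : ℝ) + 1)) ≤ t := fun n =>
      (le_div_iff₀ (hδ n)).1 (Nat.floor_le (div_nonneg ht.1.le (hδ n).le))
    have hlt : ∀ n : ℕ, t < (⌊t / (T / ((n : ℝ) + 1))⌋₊ + 1) * (T / ((n : ℝ) + 1)) := fun n =>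
      (div_lt_iff₀ (hδ n)).1 (Nat.lt_floor_add_one _)
    have h1 := tendsto_slope_of_mem_Icc (hf t ht).hasDerivAt
      (a := fun n : ℕ => ⌊t / (T / ((n : ℝ) + 1))⌋₊ * (T / ((n : ℝ) + 1)))
      (b := fun n : ℕ => (⌊t / (T / ((n : ℝ) + 1))⌋₊ + 1) * (T / ((n : ℝ) + 1)))
      (tendsto_of_tendsto_of_tendsto_of_le_of_le (g := fun n : ℕ => t - T / ((n : ℝ) + 1))
        (by simpa using hδ0.const_sub t) tendsto_const_nhds
        (fun n => by have := hlt n; dsimp only; linarith) hle)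
      (tendsto_of_tendsto_of_tendsto_of_le_of_le (h := fun n : ℕ => t + T / ((n : ℝ) + 1))
        tendsto_const_nhds (by simpa using hδ0.const_add t)
        (fun n => (hlt n).le) (fun n => by have := hle n; dsimp only; linarith))
      hle (fun n => (hlt n).le) (fun n => (hle n).trans_lt (hlt n))
    refine h1.congr fun n => ?_
    rw [← sub_mul, add_sub_cancel_left, one_mul]
  -- The step function factors through the floor into ℕ, so no measurability of f is needed.
  have hmeas : ∀ n, Measurable fun t => ‖g n t‖ₑ ^ p := fun n => by
    have h1 : Measurable fun t : ℝ => ⌊t / (T / ((n : ℝ) + 1))⌋₊ :=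
      Nat.measurable_floor.comp (measurable_id.div_const _)
    exact (Measurable.of_discrete (f := fun k : ℕ => ‖(T / ((n : ℝ) + 1))⁻¹ •
      (f ((k + 1) * (T / ((n : ℝ) + 1))) - f (k * (T / ((n : ℝ) + 1))))‖ₑ ^ p)).comp h1
  calc ∫⁻ t in Ioo 0 T, ‖deriv f t‖ₑ ^ p
      = ∫⁻ t in Ioo 0 T, liminf (fun n => ‖g n t‖ₑ ^ p) atTop :=
        setLIntegral_congr_fun measurableSet_Ioo fun t ht =>
          (((ENNReal.continuous_rpow_const.tendsto _).comp
            (hlim t ht).enorm).liminf_eq).symm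
    _ ≤ liminf (fun n => ∫⁻ t in Ioo 0 T, ‖g n t‖ₑ ^ p) atTop := lintegral_liminf_le hmeas
    _ ≤ liminf (fun _ : ℕ => rieszVariation p f 0 T) atTop :=
        liminf_le_liminf (.of_forall fun n => lintegral_uniform_slope_le hT hp f n)
    _ = rieszVariation p f 0 T := liminf_const _

theorem MemBV.memLp_deriv {T p : ℝ} (hT : 0 < T) (hp : 1 ≤ p) {f : ℝ → Rd d}
    (hBV : MemBV T p f) (hf : ∀ t ∈ Ioo 0 T, DifferentiableAt ℝ f t) :
    MemLp (deriv f) (ENNReal.ofReal p) (volume.restrict (Icc 0 T)) := by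
  have hp0 : 0 < p := by linarith
  refine ⟨(measurable_deriv f).aestronglyMeasurable, ?_⟩
  rw [eLpNorm_lt_top_iff_lintegral_rpow_enorm_lt_top (by simpa using hp0) ENNReal.ofReal_ne_top,
    ENNReal.toReal_ofReal hp0.le, ← Measure.restrict_congr_set Ioo_ae_eq_Icc]
  exact (lintegral_deriv_le_rieszVariation hT hp0.le hf).trans_lt hBV

end Variation

end SetValued

theorem theorem5 (d : ℕ) (T : ℝ) (hT : 0 < T) (p : ℝ) (hp : 1 ≤ p)
    (F : ℝ → SetValued.Conv d) (x₀ : SetValued.Rd d)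
    (hBV : SetValued.MemBV T p F)
    (hF : SetValued.HukuharaDifferentiable T F)
    (h0 : (F 0 : Set (SetValued.Rd d)) = {x₀}) :
    ∃ (f : ℕ → ℝ → SetValued.Rd d) (ξ : ℕ → SetValued.Rd d → ℝ),
      SetValued.IsCastaing T F f ∧
      (∀ n, f n ∈ SetValued.IS T p F) ∧
      (∀ n, SetValued.IsSteinerDensity (ξ n)) ∧
      (∀ n, IntegrableOn (fun s => SetValued.steiner (ξ n) (SetValued.hukuharaDeriv T F s))
        (Icc 0 T)) ∧
      (∀ n, ∀ t ∈ Icc (0 : ℝ) T,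
        f n t = x₀ + ∫ s in (0 : ℝ)..t,
          SetValued.steiner (ξ n) (SetValued.hukuharaDeriv T F s)) := by
  obtain ⟨ξ, hξ, hdense⟩ := SetValued.exists_seq_closure_steiner_eq d
  have hderiv : ∀ n, ∀ t ∈ Icc 0 T, HasDerivWithinAt (fun s => SetValued.steiner (ξ n) (F s))
      (SetValued.steiner (ξ n) (SetValued.hukuharaDeriv T F t)) (Icc 0 T) t := fun n t ht =>
    (hF.hasHukuharaDeriv ht).hasDerivWithinAt_steiner (hξ n) ht
  have hderivAt : ∀ n, ∀ t ∈ Ioo 0 T, HasDerivAt (fun s => SetValued.steiner (ξ n) (F s))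
      (SetValued.steiner (ξ n) (SetValued.hukuharaDeriv T F t)) t := fun n t ht =>
    (hderiv n t (Ioo_subset_Icc_self ht)).hasDerivAt (Icc_mem_nhds ht.1 ht.2)
  have hBV' : ∀ n, SetValued.MemBV T p fun s => SetValued.steiner (ξ n) (F s) := fun n => by
    obtain ⟨K, hK⟩ := (hξ n).exists_lipschitzWith_steiner
    exact hBV.comp_lipschitzWith (by linarith) hK
  have hLp : ∀ n, MemLp (fun s => SetValued.steiner (ξ n) (SetValued.hukuharaDeriv T F s))
      (ENNReal.ofReal p) (volume.restrict (Icc 0 T)) := fun n => by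
    -- Measurability of s ↦ St(D_H F(s)) comes from its agreement with a `deriv` on the open
    -- interval.
    refine ((hBV' n).memLp_deriv hT hp fun t ht => (hderivAt n t ht).differentiableAt).ae_eq ?_
    rw [← Measure.restrict_congr_set Ioo_ae_eq_Icc]
    filter_upwards [ae_restrict_mem measurableSet_Ioo] with t ht using (hderivAt n t ht).deriv
  have hint : ∀ n, IntegrableOn
      (fun s => SetValued.steiner (ξ n) (SetValued.hukuharaDeriv T F s)) (Icc 0 T) := fun n =>
    (hLp n).integrable (by simpa using hp)
  refine ⟨fun n t => SetValued.steiner (ξ n) (F t), ξ, fun t _ => hdense (F t), fun n => ?_,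
    fun n => (hξ n).isSteinerDensity, hint, fun n t ht => ?_⟩
  · refine ⟨⟨hBV' n, fun t _ => (hξ n).steiner_mem (F t)⟩, _,
      ⟨hLp n, .of_forall fun t => (hξ n).steiner_mem _⟩, ?_⟩
    filter_upwards [ae_restrict_mem measurableSet_Icc] with t ht using hderiv n t ht
  · have hsub : Icc 0 t ⊆ Icc 0 T := Icc_subset_Icc_right ht.2
    have h1 : SetValued.steiner (ξ n) (F 0) = x₀ := by
      have := (hξ n).steiner_mem (F 0)
      rwa [h0] at this
    -- Differentiability at every interior point, continuity on the closed interval and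
    -- integrability of the derivative suffice, without first proving absolute continuity.
    rw [intervalIntegral.integral_eq_sub_of_hasDerivAt_of_le ht.1
      (fun s hs => (hderiv n s (hsub hs)).continuousWithinAt.mono hsub)
      (fun s hs => hderivAt n s ⟨hs.1, hs.2.trans_le ht.2⟩)
      ((intervalIntegrable_iff_integrableOn_Icc_of_le ht.1).2 ((hint n).mono_set hsub)), h1,
      add_sub_cancel]
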